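/- A binary vector is \(d\)-sparse if it has at most \(d\) nonzero coordinates. For binary vectors \(x,y\) of the same length, \((x,y)\) is \((e_0,e_1)\)-close if \(y\) is obtained from \(x\) by flipping at most \(e_0\) bits from \(0\) to \(1\) and at most \(e_1\) bits from \(1\) to \(0\), and \((e_0,e_1)\)-far otherwise. For an \(M\times N\) binary matrix \(A\) and \(x\in\{0,1\}^N\), let \(A[x]\in\{0,1\}^M\) be the bitwise OR of the columns of \(A\) indexed by the support of \(x\). For real numbers \(e_0,e_1,e_0',e_1'\ge 0\), a vector \(z\in\{0,1\}^N\) is a valid decoding of \(y\in\{0,1\}^M\) if for every \(D\)-sparse \(x\in\{0,1\}^N\) such that \((x,z)\) is \((e_0',e_1')\)-far, \((A[x],y)\) is \((e_0,e_1)\)-far. The matrix \(A\) is \((e_0,e_1,e_0',e_1')\)-correcting for \(D\)-sparse vectors if every \(y\in\{0,1\}^M\) has a valid decoding. Theorem. For every choice of constants \(p\in[0,1)\) and \(\nu\in[0,\nu_0)\), where \(\nu_0:=(\sqrt{5-4p}-1)^3/8\), there are a positive integer \(C\) and a word-RAM program \(P\), both depending only on \(p\) and \(\nu\), such that for all positive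 integers \(D\) and \(N\) with \(N\ge D\) and \(N\ge 2\) there is an \(M\times N\) binary matrix \(A\) with \(M\le C\,D\log_2 N\) which is \((pM,\ (\nu/D)M,\ C D,\ 0)\)-correcting for \(D\)-sparse vectors and for which reconstruction takes time \(O(MN)\): given \(M,N,D\), the matrix \(A\) and any \(y\in\{0,1\}^M\), the program \(P\) halts after at most \(C\,MN\) steps and outputs a valid decoding of \(y\) (with respect to the same parameters), on every machine whose words have \(w\) bits with \(2^w\ge C\,MN\). -/

import Mathlib

namespace GroupTesting

/-- `(x, y)` are `(e₀, e₁)`-close: `y` is obtained from `x` by flipping at most `e₀` bits from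
`0` to `1` and at most `e₁` bits from `1` to `0`. -/
def IsClose {n : ℕ} (e₀ e₁ : ℕ) (x y : Fin n → Bool) : Prop :=
  (Finset.univ.filter fun i => x i = false ∧ y i = true).card ≤ e₀ ∧
    (Finset.univ.filter fun i => x i = true ∧ y i = false).card ≤ e₁

/-- A `d`-sparse vector has at most `d` nonzero coordinates. -/
def IsSparse {n : ℕ} (d : ℕ) (x : Fin n → Bool) : Prop :=
  (Finset.univ.filter fun i => x i = true).card ≤ d

/-- The measurement outcome `A[x]`: the bitwise OR of the columns of `A` chosen by the support
of `x`. -/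
def outcome {M N : ℕ} (A : Matrix (Fin M) (Fin N) Bool) (x : Fin N → Bool) : Fin M → Bool :=
  fun j => decide (∃ i, A j i = true ∧ x i = true)

/-- `z` is a valid decoding of `y`: for every `d`-sparse `x`, if `(x, z)` are `(e₀', e₁')`-far,
then `(A[x], y)` are `(e₀, e₁)`-far. -/
def IsValidDecoding {M N : ℕ} (A : Matrix (Fin M) (Fin N) Bool) (d e₀ e₁ e₀' e₁' : ℕ)
    (y : Fin M → Bool) (z : Fin N → Bool) : Prop :=
  ∀ x : Fin N → Bool, IsSparse d x → ¬ IsClose e₀' e₁' x z → ¬ IsClose e₀ e₁ (outcome A x) y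

/-- `A` is `(e₀, e₁, e₀', e₁')`-correcting for `d`-sparse vectors. -/
def IsCorrecting {M N : ℕ} (A : Matrix (Fin M) (Fin N) Bool) (d e₀ e₁ e₀' e₁' : ℕ) : Prop :=
  ∀ y : Fin M → Bool, ∃ z : Fin N → Bool, IsValidDecoding A d e₀ e₁ e₀' e₁' y z

end GroupTesting

/-! A word RAM. Registers and memory cells hold words of `w` bits. Registers are named by literals
in the program; memory is addressed indirectly through registers. Every instruction takes
one step. -/

namespace WordRAM

/-- Instructions; `r s t` name registers, `l` is a position in the program. -/
inductive Instr where
  /-- `r := c`, for a literal `c` -/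
  | const (r c : ℕ)
  /-- `r := s + t` -/
  | add (r s t : ℕ)
  /-- `r := s - t`, truncated at `0` -/
  | sub (r s t : ℕ)
  /-- `r := s * t` -/
  | mul (r s t : ℕ)
  /-- `r := ⌊s / t⌋`, with value `0` when `t` holds `0` -/
  | div (r s t : ℕ)
  /-- `r :=` the memory cell whose address is in `s` -/
  | load (r s : ℕ)
  /-- the memory cell whose address is in `r` `:= s` -/
  | store (r s : ℕ)
  /-- go to `l` -/
  | jump (l : ℕ)
  /-- go to `l` if `r ≤ s` -/
  | jumpLe (r s l : ℕ)

/-- A program is a finite list of instructions. -/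
abbrev Program := List Instr

/-- Program counter, registers, memory. -/
structure State where
  pc : ℕ
  reg : ℕ → ℕ
  mem : ℕ → ℕ

/-- Write the `w`-bit word `v mod 2 ^ w` into register `r` and move to the next instruction. -/
def State.setReg (w : ℕ) (σ : State) (r v : ℕ) : State :=
  { σ with pc := σ.pc + 1, reg := Function.update σ.reg r (v % 2 ^ w) }

/-- Execute one instruction with word length `w`. -/
def exec (w : ℕ) (σ : State) : Instr → State
  | .const r c => σ.setReg w r c
  | .add r s t => σ.setReg w r (σ.reg s + σ.reg t)
  | .sub r s t => σ.setReg w r (σ.reg s - σ.reg t)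
  | .mul r s t => σ.setReg w r (σ.reg s * σ.reg t)
  | .div r s t => σ.setReg w r (σ.reg s / σ.reg t)
  | .load r s => σ.setReg w r (σ.mem (σ.reg s))
  | .store r s => { σ with pc := σ.pc + 1, mem := Function.update σ.mem (σ.reg r) (σ.reg s) }
  | .jump l => { σ with pc := l }
  | .jumpLe r s l => { σ with pc := if σ.reg r ≤ σ.reg s then l else σ.pc + 1 }

/-- One step. The machine has halted, and its state no longer changes, once the program counter
has left the program. -/
def step (P : Program) (w : ℕ) (σ : State) : State :=
  match P[σ.pc]? with
  | some I => exec w σ I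
  | none => σ

/-- The state after `t` steps. -/
def run (P : Program) (w t : ℕ) (σ : State) : State := (step P w)^[t] σ

/-- The state `σ` is a halting state of `P`. -/
def Halted (P : Program) (σ : State) : Prop := P.length ≤ σ.pc

end WordRAM

namespace GroupTesting

open WordRAM

/-- The start of a decoder on a matrix `A` (stored row by row, from address `0` on), the observed
outcomes `y` (stored after `A`), and the numbers `M`, `N`, `D` in registers `0`, `1`, `2`. Everything
else is `0`. -/
def decoderInput {M N : ℕ} (A : Matrix (Fin M) (Fin N) Bool) (D : ℕ) (y : Fin M → Bool) : State where
  pc := 0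
  reg := fun r => if r = 0 then M else if r = 1 then N else if r = 2 then D else 0
  mem := fun a =>
    if ∃ q : Fin M × Fin N, a = q.1 * N + q.2 ∧ A q.1 q.2 = true then 1
    else if ∃ j : Fin M, a = M * N + j ∧ y j = true then 1
    else 0

/-- The vector `z` can be read off the state: it is stored directly after `A` and `y`. -/
def HasOutput {N : ℕ} (M : ℕ) (σ : State) (z : Fin N → Bool) : Prop :=
  ∀ i : Fin N, σ.mem (M * N + M + i) = if z i = true then 1 else 0

/-- `P` is a reconstruction algorithm for `A`: for every observed `y` it halts within `t` steps with
a valid decoding of `y` as its output, on every machine whose words can hold the numbers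
below `B`. -/
def Reconstructs (P : Program) (B t : ℕ) {M N : ℕ} (A : Matrix (Fin M) (Fin N) Bool)
    (D e₀ e₁ e₀' e₁' : ℕ) : Prop :=
  ∀ (y : Fin M → Bool) (w : ℕ), B ≤ 2 ^ w →
    Halted P (run P w t (decoderInput A D y)) ∧
      ∃ z : Fin N → Bool, HasOutput M (run P w t (decoderInput A D y)) z ∧
        IsValidDecoding A D e₀ e₁ e₀' e₁' y z

end GroupTesting

/-! ### Random rows and their moments. -/

namespace GroupTesting

/-! Choose the entries of `A` independently, each one with probability `α / D`, and decode by a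
threshold: keep an item when at most `β * M / D` negative tests contain it, where `β` is a rational
number between `ν` and `ν₀`. No item of `x` is lost, since every negative test containing it is a
flip from 1 to 0 and there are at most `ν * M / D` of these.

Suppose more than `C * D` items were kept wrongly. Let `S` be `C₁ * D` of them, and let `X` be `D`
items outside `S` that cover the support of `x`. A test avoiding `X` has true outcome 0. If it is
observed negative, its ones in `S` count as misses, of which there are at most `β * C₁ * M` in all.
If it is observed positive, it is one of at most `p * M` flips from 0 to 1. Capping the ones of each
row at their mean `τ = α * C₁` limits what a flip can hide, so the total `gain` is at most `(β * C₁
+ τ * p) * M`.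

For a random row the expected gain is at least `τ * (1 - α)` minus a fluctuation that is small
compared with `C₁` (`le_sum_rowWeight_mul_gain`). As `β < α * (1 - α - p)`, a large constant `C₁`
makes this exceed the bound above by 1. A Chernoff bound whose rate depends only on `τ`, with a
union bound over at most `N ^ ((C₁ + 1) * D)` pairs `(X, S)`, yields a matrix contradicting the
upper bound for every pair once `M` is of order `D * log N` (`exists_forall_lt_sum`,
`exists_matrix_lt_sum_gain`). The combinatorial argument is `isValidDecoding_thresholdDecode`; the
decoder is a double loop over items and tests, hence `O(MN)` steps
(`reconstructs_thresholdProgram`). -/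

/-- The probability of the row `r` when its entries are independent, each `true` with
probability `q`. -/
noncomputable def rowWeight {ι : Type*} [Fintype ι] (q : ℝ) (r : ι → Bool) : ℝ :=
  ∏ i, if r i = true then q else 1 - q

/-- The value of a bit as a real number. -/
noncomputable def bit (b : Bool) : ℝ := if b = true then 1 else 0

/-- The number of ones of `r` in `S`. -/
noncomputable def rowSum {ι : Type*} (S : Finset ι) (r : ι → Bool) : ℝ := ∑ i ∈ S, bit (r i)

open Classical in
/-- The number of ones of `r` in `S`, capped at `τ`, if `r` vanishes on `X`, and `0` otherwise. -/
noncomputable def gain {ι : Type*} (X S : Finset ι) (τ : ℝ) (r : ι → Bool) : ℝ :=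
  if ∃ i ∈ X, r i = true then 0 else min (rowSum S r) τ

theorem bit_nonneg (b : Bool) : 0 ≤ bit b := by unfold bit; split_ifs <;> norm_num

theorem bit_mul_self (b : Bool) : bit b * bit b = bit b := by unfold bit; split_ifs <;> norm_num

theorem rowSum_nonneg {ι : Type*} (S : Finset ι) (r : ι → Bool) : 0 ≤ rowSum S r :=
  Finset.sum_nonneg fun _ _ => bit_nonneg _

theorem gain_nonneg {ι : Type*} (X S : Finset ι) {τ : ℝ} (hτ : 0 ≤ τ) (r : ι → Bool) :
    0 ≤ gain X S τ r := by
  unfold gain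
  split_ifs
  · exact le_rfl
  · exact le_min (rowSum_nonneg _ _) hτ

theorem gain_le {ι : Type*} (X S : Finset ι) {τ : ℝ} (hτ : 0 ≤ τ) (r : ι → Bool) :
    gain X S τ r ≤ τ := by
  unfold gain
  split_ifs
  · exact hτ
  · exact min_le_right _ _

theorem rowWeight_nonneg {ι : Type*} [Fintype ι] {q : ℝ} (hq₀ : 0 ≤ q) (hq₁ : q ≤ 1)
    (r : ι → Bool) : 0 ≤ rowWeight q r :=
  Finset.prod_nonneg fun _ _ => by split_ifs <;> linarith

section Moments

variable {ι : Type*} [Fintype ι] [DecidableEq ι]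

/-- The weight is a product, so the sum factors over coordinates. All moments used below are
instances with at most two indices. -/
theorem sum_rowWeight_mul_prod (q : ℝ) (T : Finset ι) :
    ∑ r : ι → Bool, rowWeight q r * ∏ i ∈ T, bit (r i) = q ^ T.card := by
  have h : ∀ r : ι → Bool, rowWeight q r * ∏ i ∈ T, bit (r i) =
      ∏ i, (if r i = true then q else 1 - q) * (if i ∈ T then bit (r i) else 1) := by
    intro r
    rw [Finset.prod_mul_distrib, Finset.prod_ite_mem, Finset.univ_inter]
    rfl
  simp_rw [h]
  rw [← Fintype.piFinset_univ, ← Finset.prod_univ_sum (fun _ : ι => (Finset.univ : Finset Bool))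
    (fun i b => (if b = true then q else 1 - q) * (if i ∈ T then bit b else 1))]
  have h2 : ∀ i : ι, ∑ b : Bool, (if b = true then q else 1 - q) * (if i ∈ T then bit b else 1) =
      if i ∈ T then q else 1 := by
    intro i
    by_cases hi : i ∈ T <;> simp [hi, bit]
  simp_rw [h2]
  simp [Finset.prod_ite_mem]

theorem sum_rowWeight (q : ℝ) : ∑ r : ι → Bool, rowWeight q r = 1 := by
  simpa using sum_rowWeight_mul_prod q (∅ : Finset ι)

theorem sum_rowWeight_mul_bit (q : ℝ) (i : ι) :
    ∑ r : ι → Bool, rowWeight q r * bit (r i) = q := by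
  simpa using sum_rowWeight_mul_prod q ({i} : Finset ι)

theorem sum_rowWeight_mul_bit_mul_bit (q : ℝ) {i k : ι} (h : i ≠ k) :
    ∑ r : ι → Bool, rowWeight q r * (bit (r i) * bit (r k)) = q ^ 2 := by
  simpa [Finset.prod_pair h, Finset.card_pair h] using
    sum_rowWeight_mul_prod q ({i, k} : Finset ι)

theorem sum_rowWeight_mul_rowSum (q : ℝ) (S : Finset ι) :
    ∑ r : ι → Bool, rowWeight q r * rowSum S r = q * S.card := by
  simp_rw [rowSum, Finset.mul_sum]
  rw [Finset.sum_comm]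
  simp_rw [sum_rowWeight_mul_bit]
  simp [mul_comm]

theorem sum_rowWeight_mul_bit_mul_rowSum (q : ℝ) {S : Finset ι} {i : ι} (hi : i ∉ S) :
    ∑ r : ι → Bool, rowWeight q r * (bit (r i) * rowSum S r) = q * (q * S.card) := by
  simp_rw [rowSum, Finset.mul_sum]
  rw [Finset.sum_comm, Finset.sum_congr rfl fun k hk =>
    sum_rowWeight_mul_bit_mul_bit q (i := i) (k := k) (by rintro rfl; exact hi hk)]
  simp; ring

theorem sum_rowWeight_mul_rowSum_sq_le (q : ℝ) (S : Finset ι) :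
    ∑ r : ι → Bool, rowWeight q r * rowSum S r ^ 2 ≤ q * S.card + (q * S.card) ^ 2 := by
  have h : ∀ i ∈ S, ∀ k ∈ S, ∑ r : ι → Bool, rowWeight q r * (bit (r i) * bit (r k)) ≤
      q ^ 2 + if i = k then q else 0 := by
    intro i _ k _
    by_cases hik : i = k
    · subst hik
      simp_rw [bit_mul_self, sum_rowWeight_mul_bit]
      simp [sq_nonneg]
    · rw [sum_rowWeight_mul_bit_mul_bit q hik]
      simp [hik]
  calc ∑ r : ι → Bool, rowWeight q r * rowSum S r ^ 2
      = ∑ i ∈ S, ∑ k ∈ S, ∑ r : ι → Bool, rowWeight q r * (bit (r i) * bit (r k)) := by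
        simp_rw [sq, rowSum, Finset.sum_mul_sum, Finset.mul_sum]
        rw [Finset.sum_comm]
        exact Finset.sum_congr rfl fun i _ => Finset.sum_comm
    _ ≤ ∑ i ∈ S, ∑ k ∈ S, (q ^ 2 + if i = k then q else 0) :=
        Finset.sum_le_sum fun i hi => Finset.sum_le_sum fun k hk => h i hi k hk
    _ = q * S.card + (q * S.card) ^ 2 := by
        simp [Finset.sum_add_distrib]
        ring

/-- The expected gain, bounded below by a second moment computation. -/
theorem le_sum_rowWeight_mul_gain {q κ : ℝ} (hq₀ : 0 ≤ q) (hq₁ : q ≤ 1) (hκ : 0 < κ)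
    {X S : Finset ι} (hXS : Disjoint X S) :
    q * S.card - q * S.card / (4 * κ) - κ / 4 - X.card * q * (q * S.card) ≤
      ∑ r : ι → Bool, rowWeight q r * gain X S (q * S.card) r := by
  set τ : ℝ := q * S.card with hτ
  have hτ₀ : 0 ≤ τ := by positivity
  -- Use `min W τ = (W + τ) / 2 - |W - τ| / 2` with `|W - τ| ≤ (W - τ) ^ 2 / (2 * κ) + κ / 2`. Rows
  -- meeting `X` are paid for by subtracting `W` once for each one in `X`, which makes the bound a
  -- polynomial in the bits.
  have hpt : ∀ r : ι → Bool,
      (rowSum S r + τ) / 2 - (rowSum S r ^ 2 - 2 * τ * rowSum S r + τ ^ 2) / (4 * κ) - κ / 4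
        - ∑ i ∈ X, bit (r i) * rowSum S r ≤ gain X S τ r := by
    intro r
    set W := rowSum S r with hW
    have hW₀ : 0 ≤ W := rowSum_nonneg S r
    have hmin : (W + τ) / 2 - (W ^ 2 - 2 * τ * W + τ ^ 2) / (4 * κ) - κ / 4 ≤ min W τ := by
      have habs : |W - τ| ≤ (W ^ 2 - 2 * τ * W + τ ^ 2) / (2 * κ) + κ / 2 := by
        have : (W ^ 2 - 2 * τ * W + τ ^ 2) / (2 * κ) + κ / 2 - |W - τ| =
            (|W - τ| - κ) ^ 2 / (2 * κ) := by
          have := sq_abs (W - τ)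
          field_simp
          nlinarith
        have h2 : 0 ≤ (|W - τ| - κ) ^ 2 / (2 * κ) := by positivity
        linarith
      have hsplit : (W ^ 2 - 2 * τ * W + τ ^ 2) / (4 * κ) =
          (W ^ 2 - 2 * τ * W + τ ^ 2) / (2 * κ) / 2 := by field_simp; ring
      rw [hsplit]
      rw [abs_le] at habs
      exact le_min (by linarith) (by linarith)
    have hnn : ∀ i ∈ X, 0 ≤ bit (r i) * W := fun i _ => mul_nonneg (bit_nonneg _) hW₀
    unfold gain
    split_ifs with h
    · obtain ⟨i, hi, hri⟩ := h
      have h1 := Finset.single_le_sum hnn hi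
      simp only [bit, hri, if_true, one_mul] at h1
      have := min_le_left W τ
      simp only [bit]
      linarith
    · have := Finset.sum_nonneg hnn
      linarith
  have hE := Finset.sum_le_sum fun r (_ : r ∈ Finset.univ) =>
    mul_le_mul_of_nonneg_left (hpt r) (rowWeight_nonneg hq₀ hq₁ r)
  refine le_trans ?_ hE
  have hX : ∑ r : ι → Bool, rowWeight q r * ∑ i ∈ X, bit (r i) * rowSum S r =
      X.card * q * τ := by
    simp_rw [Finset.mul_sum]
    rw [Finset.sum_comm, Finset.sum_congr rfl fun i hi =>
      sum_rowWeight_mul_bit_mul_rowSum q (Finset.disjoint_left.1 hXS hi)]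
    simp [hτ]; ring
  have hsplit : ∑ r : ι → Bool, rowWeight q r *
      ((rowSum S r + τ) / 2 - (rowSum S r ^ 2 - 2 * τ * rowSum S r + τ ^ 2) / (4 * κ) - κ / 4
        - ∑ i ∈ X, bit (r i) * rowSum S r) =
      (1 / 2 + 2 * τ / (4 * κ)) * ∑ r : ι → Bool, rowWeight q r * rowSum S r
      - 1 / (4 * κ) * ∑ r : ι → Bool, rowWeight q r * rowSum S r ^ 2
      + (τ / 2 - τ ^ 2 / (4 * κ) - κ / 4) * ∑ r : ι → Bool, rowWeight q r
      - ∑ r : ι → Bool, rowWeight q r * ∑ i ∈ X, bit (r i) * rowSum S r := by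
    simp_rw [Finset.mul_sum (s := (Finset.univ : Finset (ι → Bool)))]
    rw [← Finset.sum_sub_distrib, ← Finset.sum_add_distrib, ← Finset.sum_sub_distrib]
    refine Finset.sum_congr rfl fun r _ => ?_
    ring
  rw [hsplit, hX, sum_rowWeight, sum_rowWeight_mul_rowSum, ← hτ]
  have h2 := mul_le_mul_of_nonneg_left (sum_rowWeight_mul_rowSum_sq_le q S)
    (show 0 ≤ 1 / (4 * κ) by positivity)
  rw [← hτ] at h2
  have h3 : 1 / (4 * κ) * (τ + τ ^ 2) = τ / (4 * κ) + τ ^ 2 / (4 * κ) := by ring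
  have h4 : (1 / 2 + 2 * τ / (4 * κ)) * τ = τ / 2 + 2 * (τ ^ 2 / (4 * κ)) := by ring
  linarith

end Moments

/-! ### Concentration and the union bound. -/

theorem exp_neg_le {u : ℝ} (hu : 0 ≤ u) : Real.exp (-u) ≤ 1 - u + u ^ 2 := by
  have h1 : 1 + u ≤ Real.exp u := by linarith [Real.add_one_le_exp u]
  rw [Real.exp_neg]
  refine (inv_anti₀ (by linarith) h1).trans ?_
  rw [inv_le_iff_one_le_mul₀ (by linarith)]
  nlinarith [pow_nonneg hu 3]

/-- Chernoff's bound on the exponential moment of the lower tail. -/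
theorem sum_mul_exp_le {Ω : Type*} [Fintype Ω] {μ : Ω → ℝ} (hμ : ∀ ω, 0 ≤ μ ω)
    (hμ₁ : ∑ ω, μ ω = 1) {G : Ω → ℝ} {τ θ : ℝ} (hτ : 0 < τ) (hG₀ : ∀ ω, 0 ≤ G ω)
    (hG₁ : ∀ ω, G ω ≤ τ) (hE : θ + 1 ≤ ∑ ω, μ ω * G ω) :
    ∑ ω, μ ω * Real.exp (-(1 / (2 * τ ^ 2)) * (G ω - θ)) ≤ Real.exp (-(1 / (4 * τ ^ 2))) := by
  -- The exponent comes out as `-l + l ^ 2 * τ ^ 2`, thanks to the unit gap in `hE`; this `l`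
  -- minimizes it.
  set l : ℝ := 1 / (2 * τ ^ 2) with hl
  have hl₀ : 0 ≤ l := by positivity
  have hlτ : l * τ ^ 2 = 1 / 2 := by rw [hl]; field_simp
  have hpt : ∀ ω, Real.exp (-l * (G ω - θ)) ≤
      Real.exp (l * θ) * (1 - l * G ω + l ^ 2 * τ ^ 2) := by
    intro ω
    have h1 := exp_neg_le (mul_nonneg hl₀ (hG₀ ω))
    have h2 : (l * G ω) ^ 2 ≤ l ^ 2 * τ ^ 2 := by
      rw [mul_pow]
      exact mul_le_mul_of_nonneg_left (pow_le_pow_left₀ (hG₀ ω) (hG₁ ω) 2) (sq_nonneg l)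
    rw [show -l * (G ω - θ) = l * θ + -(l * G ω) by ring, Real.exp_add]
    exact mul_le_mul_of_nonneg_left (by linarith) (Real.exp_pos _).le
  calc ∑ ω, μ ω * Real.exp (-l * (G ω - θ))
      ≤ ∑ ω, μ ω * (Real.exp (l * θ) * (1 - l * G ω + l ^ 2 * τ ^ 2)) :=
        Finset.sum_le_sum fun ω _ => mul_le_mul_of_nonneg_left (hpt ω) (hμ ω)
    _ = Real.exp (l * θ) * ((1 + l ^ 2 * τ ^ 2) * ∑ ω, μ ω - l * ∑ ω, μ ω * G ω) := by
        rw [Finset.mul_sum, Finset.mul_sum, ← Finset.sum_sub_distrib, Finset.mul_sum]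
        exact Finset.sum_congr rfl fun ω _ => by ring
    _ ≤ Real.exp (l * θ) * Real.exp (-(l * (θ + 1)) + l ^ 2 * τ ^ 2) := by
        refine mul_le_mul_of_nonneg_left ?_ (Real.exp_pos _).le
        rw [hμ₁]
        have := Real.add_one_le_exp (-(l * (θ + 1)) + l ^ 2 * τ ^ 2)
        have := mul_le_mul_of_nonneg_left hE hl₀
        linarith
    _ = Real.exp (-(1 / (4 * τ ^ 2))) := by
        rw [← Real.exp_add]
        congr 1
        have h5 : l ^ 2 * τ ^ 2 = l / 2 := by rw [sq, mul_assoc, hlτ]; ring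
        have h6 : 1 / (4 * τ ^ 2) = l / 2 := by rw [hl]; field_simp; ring
        rw [h5, h6]; ring

/-- The union bound over a finite family of lower tail events for `M` independent samples. -/
theorem exists_forall_lt_sum {Ω Φ : Type*} [Fintype Ω] (F : Finset Φ) {μ : Ω → ℝ}
    (hμ : ∀ ω, 0 ≤ μ ω) (hμ₁ : ∑ ω, μ ω = 1) (G : Φ → Ω → ℝ) {τ θ : ℝ} (hτ : 0 < τ)
    (hG₀ : ∀ φ ∈ F, ∀ ω, 0 ≤ G φ ω) (hG₁ : ∀ φ ∈ F, ∀ ω, G φ ω ≤ τ)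
    (hE : ∀ φ ∈ F, θ + 1 ≤ ∑ ω, μ ω * G φ ω) (M : ℕ)
    (hM : F.card * Real.exp (-(1 / (4 * τ ^ 2))) ^ M < 1) :
    ∃ s : Fin M → Ω, ∀ φ ∈ F, θ * M < ∑ j, G φ (s j) := by
  classical
  by_contra! hcon
  set l : ℝ := 1 / (2 * τ ^ 2) with hl
  have hl₀ : 0 ≤ l := by positivity
  -- If every sample fails for some `φ`, the corresponding exponential is at least 1; averaging over
  -- samples contradicts `hM`.
  have h1 : ∀ s : Fin M → Ω, 1 ≤ ∑ φ ∈ F, ∏ j, Real.exp (-l * (G φ (s j) - θ)) := by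
    intro s
    obtain ⟨φ, hφ, hle⟩ := hcon s
    refine le_trans ?_ (Finset.single_le_sum (f := fun φ => ∏ j, Real.exp (-l * (G φ (s j) - θ)))
      (fun φ _ => Finset.prod_nonneg fun j _ => (Real.exp_pos _).le) hφ)
    rw [← Real.exp_sum, ← Finset.mul_sum, Finset.sum_sub_distrib]
    apply Real.one_le_exp
    simp only [Finset.sum_const, Finset.card_univ, Fintype.card_fin, nsmul_eq_mul]
    nlinarith
  have h2 : (1 : ℝ) ≤ ∑ s : Fin M → Ω, (∏ j, μ (s j)) *
      ∑ φ ∈ F, ∏ j, Real.exp (-l * (G φ (s j) - θ)) := by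
    calc (1 : ℝ) = ∑ s : Fin M → Ω, (∏ j, μ (s j)) * 1 := by
          simp_rw [mul_one]
          rw [← Fintype.sum_pow, hμ₁, one_pow]
      _ ≤ _ := Finset.sum_le_sum fun s _ =>
          mul_le_mul_of_nonneg_left (h1 s) (Finset.prod_nonneg fun j _ => hμ _)
  have h3 : ∑ s : Fin M → Ω, (∏ j, μ (s j)) * ∑ φ ∈ F, ∏ j, Real.exp (-l * (G φ (s j) - θ)) =
      ∑ φ ∈ F, (∑ ω, μ ω * Real.exp (-l * (G φ ω - θ))) ^ M := by
    simp_rw [Finset.mul_sum, ← Finset.prod_mul_distrib]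
    rw [Finset.sum_comm]
    refine Finset.sum_congr rfl fun φ _ => ?_
    rw [Fintype.sum_pow]
  have h4 : ∑ φ ∈ F, (∑ ω, μ ω * Real.exp (-l * (G φ ω - θ))) ^ M ≤
      F.card * Real.exp (-(1 / (4 * τ ^ 2))) ^ M := by
    rw [← nsmul_eq_mul]
    refine Finset.sum_le_card_nsmul _ _ _ fun φ hφ => ?_
    exact pow_le_pow_left₀ (Finset.sum_nonneg fun ω _ => mul_nonneg (hμ ω) (Real.exp_pos _).le)
      (sum_mul_exp_le hμ hμ₁ hτ (hG₀ φ hφ) (hG₁ φ hφ) (hE φ hφ)) M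
  linarith

/-! ### Threshold decoding: the matrix and its correctness. -/

/-- The number of tests that contain the item `i` and came out negative. -/
def missCount {M N : ℕ} (A : Matrix (Fin M) (Fin N) Bool) (y : Fin M → Bool) (i : Fin N) : ℕ :=
  (Finset.univ.filter fun j => A j i = true ∧ y j = false).card

/-- Threshold decoding: keep the items with at most `a / (b * D) * M` negative tests. -/
def thresholdDecode {M N : ℕ} (A : Matrix (Fin M) (Fin N) Bool) (D a b : ℕ) (y : Fin M → Bool) :
    Fin N → Bool :=
  fun i => decide (missCount A y i * (b * D) ≤ a * M)

theorem exists_matrix_lt_sum_gain {α β p : ℝ} (hα₀ : 0 < α) (hα₁ : α ≤ 1)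
    (hβ : β < α * (1 - α - p)) :
    ∃ C₁ C₂ : ℕ, 1 ≤ C₂ ∧ ∀ D N M : ℕ, 1 ≤ D → 2 ≤ N → C₂ * (D * Real.logb 2 N) ≤ M →
      ∃ A : Matrix (Fin M) (Fin N) Bool, ∀ X S : Finset (Fin N), Disjoint X S → X.card = D →
        S.card = C₁ * D →
          (β * C₁ + α * C₁ * p) * M < ∑ j, gain X S (α * C₁) (A j) := by
  obtain ⟨η, hη₀, hη⟩ : ∃ η : ℝ, 0 < η ∧ 2 * η = α * (1 - α - p) - β :=
    ⟨(α * (1 - α - p) - β) / 2, by linarith, by ring⟩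
  -- The slack per row is `2 * η * C₁`. This `κ` makes the loss `τ / (4 * κ)` equal to half of it,
  -- and `C₁` is chosen so that the other half covers `κ / 4` and the unit gap.
  set κ : ℝ := α / (4 * η) with hκ
  have hκ₀ : 0 < κ := by positivity
  obtain ⟨C₁, hC₁⟩ := exists_nat_ge ((1 + κ / 4) / η)
  have hC₁' : 1 + κ / 4 ≤ C₁ * η := (div_le_iff₀ hη₀).1 hC₁
  have hC₁₀ : (0 : ℝ) < C₁ := lt_of_lt_of_le (by positivity) hC₁
  set τ : ℝ := α * C₁ with hτ
  have hτ₀ : 0 < τ := by positivity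
  obtain ⟨C₂, hC₂⟩ := exists_nat_gt ((C₁ + 1) * (4 * τ ^ 2))
  have hC₂₀ : (0 : ℝ) < C₂ := lt_trans (by positivity) hC₂
  refine ⟨C₁, C₂, by exact_mod_cast hC₂₀, fun D N M hD hN hM => ?_⟩
  have hD₀ : (0 : ℝ) < D := by exact_mod_cast hD
  have hD₁ : (1 : ℝ) ≤ D := by exact_mod_cast hD
  have hN₀ : (0 : ℝ) < N := by exact_mod_cast (by omega : 0 < N)
  have hlog : 0 < Real.log N := Real.log_pos (by exact_mod_cast hN)
  set F : Finset (Finset (Fin N) × Finset (Fin N)) :=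
    ((Finset.univ.powersetCard D) ×ˢ (Finset.univ.powersetCard (C₁ * D))).filter
      (fun φ => Disjoint φ.1 φ.2) with hF
  have hmem : ∀ φ ∈ F, φ.1.card = D ∧ φ.2.card = C₁ * D ∧ Disjoint φ.1 φ.2 := by
    intro φ hφ
    simp only [hF, Finset.mem_filter, Finset.mem_product, Finset.mem_powersetCard] at hφ
    exact ⟨hφ.1.1.2, hφ.1.2.2, hφ.2⟩
  set q : ℝ := α / D with hq
  have hq₀ : 0 ≤ q := by positivity
  have hq₁ : q ≤ 1 := by rw [hq, div_le_one hD₀]; linarith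
  have hchoose : ∀ k : ℕ, (N.choose k : ℝ) ≤ (N : ℝ) ^ k := fun k =>
    (Nat.choose_le_pow_div k N).trans (div_le_self (by positivity)
      (by exact_mod_cast Nat.one_le_iff_ne_zero.2 (Nat.factorial_ne_zero k)))
  have hFcard : (F.card : ℝ) ≤ Real.exp ((C₁ + 1) * (D * Real.log N)) := by
    calc (F.card : ℝ) ≤ (N.choose D : ℝ) * N.choose (C₁ * D) := by
          have := Finset.card_filter_le ((Finset.univ.powersetCard D) ×ˢ
            (Finset.univ.powersetCard (C₁ * D))) (fun φ : Finset (Fin N) × Finset (Fin N) =>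
              Disjoint φ.1 φ.2)
          simp only [Finset.card_product, Finset.card_powersetCard, Finset.card_univ,
            Fintype.card_fin] at this
          exact_mod_cast this
      _ ≤ (N : ℝ) ^ D * (N : ℝ) ^ (C₁ * D) :=
          mul_le_mul (hchoose _) (hchoose _) (Nat.cast_nonneg _) (by positivity)
      _ = Real.exp ((C₁ + 1) * (D * Real.log N)) := by
          rw [← pow_add]
          conv_lhs => rw [← Real.exp_log hN₀]
          rw [← Real.exp_nat_mul]
          push_cast
          ring_nf
  obtain ⟨A, hA⟩ := exists_forall_lt_sum F (rowWeight_nonneg (ι := Fin N) hq₀ hq₁)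
    (sum_rowWeight q) (fun φ => gain φ.1 φ.2 τ) (θ := β * C₁ + τ * p) hτ₀
    (fun φ _ r => gain_nonneg _ _ hτ₀.le r) (fun φ _ r => gain_le _ _ hτ₀.le r)
    (by
      intro φ hφ
      obtain ⟨h1, h2, h3⟩ := hmem φ hφ
      have h := le_sum_rowWeight_mul_gain hq₀ hq₁ hκ₀ h3
      have hqD : (D : ℝ) * q = α := by rw [hq]; field_simp
      have hqS : q * (φ.2.card : ℝ) = τ := by
        rw [h2, hτ, ← hqD]; push_cast; ring
      rw [hqS, h1, hqD] at h
      refine le_trans ?_ h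
      have h5 : τ / (4 * κ) = C₁ * η := by rw [hτ, hκ]; field_simp
      have h6 : C₁ * (2 * η) = C₁ * (α * (1 - α - p) - β) := by rw [hη]
      rw [h5, hτ]
      nlinarith)
    M
    (by
      have hlogb : Real.log N ≤ Real.logb 2 N := by
        rw [Real.logb, le_div_iff₀ (Real.log_pos one_lt_two)]
        nlinarith [Real.log_two_lt_d9]
      have hM' : C₂ * (D * Real.log N) ≤ M := le_trans (by gcongr) hM
      rw [← Real.exp_nat_mul]
      refine lt_of_le_of_lt (mul_le_mul_of_nonneg_right hFcard (Real.exp_pos _).le) ?_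
      rw [← Real.exp_add, Real.exp_lt_one_iff]
      have h7 : (C₁ + 1) * (D * Real.log N) * (4 * τ ^ 2) < M := by
        refine lt_of_lt_of_le ?_ hM'
        rw [mul_right_comm]
        exact mul_lt_mul_of_pos_right hC₂ (by positivity)
      have h8 := (lt_div_iff₀ (by positivity : 0 < 4 * τ ^ 2)).2 h7
      rw [mul_neg, mul_one_div]
      linarith)
  refine ⟨A, fun X S hXS hX hS => hA (X, S) ?_⟩
  simp [hF, Finset.mem_powersetCard, hX, hS, hXS]

/-- Too many false positives would bound the total gain of some pair `(X, S)` from above by misses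
plus hidden ones, against `hA`. The randomness enters only through `hA`, so the conclusion holds for
all `y` at once. -/
theorem isValidDecoding_thresholdDecode {M N D C₁ C a b : ℕ} {α p ν : ℝ} (hα : 0 ≤ α)
    (hp : 0 ≤ p) (hν : 0 ≤ ν) (hD : 1 ≤ D) (hb : 1 ≤ b) (hνab : ν ≤ a / b) (hC : C₁ + 1 ≤ C)
    {A : Matrix (Fin M) (Fin N) Bool}
    (hA : ∀ X S : Finset (Fin N), Disjoint X S → X.card = D → S.card = C₁ * D →
      ((a / b : ℝ) * C₁ + α * C₁ * p) * M < ∑ j, gain X S (α * C₁) (A j)) (y : Fin M → Bool) :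
    IsValidDecoding A D ⌊p * M⌋₊ ⌊ν / D * M⌋₊ (C * D) 0 y (thresholdDecode A D a b y) := by
  have hD₀ : (0 : ℝ) < D := by exact_mod_cast hD
  have hb₀ : (0 : ℝ) < b := by exact_mod_cast hb
  rintro x hx hfar ⟨h0, h1⟩
  refine hfar ⟨?_, ?_⟩
  · by_contra! hbig
    set Z := Finset.univ.filter fun i => x i = false ∧ thresholdDecode A D a b y i = true with hZ
    have hCD : (C₁ + 1) * D ≤ C * D := Nat.mul_le_mul_right D hC
    rw [add_mul, one_mul] at hCD
    obtain ⟨S, hSZ, hS⟩ := Finset.exists_subset_card_eq (s := Z) (n := C₁ * D) (by omega)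
    have hxS : (Finset.univ.filter fun i => x i = true) ⊆ Finset.univ \ S := by
      intro i hi
      simp only [Finset.mem_filter, Finset.mem_univ, true_and] at hi
      simp only [Finset.mem_sdiff, Finset.mem_univ, true_and]
      intro hiS
      have := (Finset.mem_filter.1 (hSZ hiS)).2.1
      simp [hi] at this
    -- There is room to pad the support to exactly `D` items outside `S`: more than `D` elements of
    -- `Z` remain, because `C ≥ C₁ + 1`.
    obtain ⟨X, hxX, hXS, hX⟩ := Finset.exists_subsuperset_card_eq hxS hx (by
      have := Finset.card_le_card (Finset.sdiff_subset_sdiff (Finset.subset_univ Z) subset_rfl :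
        Z \ S ⊆ Finset.univ \ S)
      rw [Finset.card_sdiff_of_subset hSZ] at this
      omega)
    have hdisj : Disjoint X S :=
      Finset.disjoint_left.2 fun i hi => (Finset.mem_sdiff.1 (hXS hi)).2
    have hlt := hA X S hdisj hX hS
    have hτ : 0 ≤ α * C₁ := by positivity
    have hpt : ∀ j, gain X S (α * C₁) (A j) ≤
        (∑ i ∈ S, if A j i = true ∧ y j = false then (1 : ℝ) else 0) +
          α * C₁ * if outcome A x j = false ∧ y j = true then (1 : ℝ) else 0 := by
      intro j
      have hnn : 0 ≤ ∑ i ∈ S, if A j i = true ∧ y j = false then (1 : ℝ) else 0 :=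
        Finset.sum_nonneg fun i _ => by split_ifs <;> norm_num
      have hnn' : 0 ≤ α * C₁ * if outcome A x j = false ∧ y j = true then (1 : ℝ) else 0 :=
        mul_nonneg hτ (by split_ifs <;> norm_num)
      by_cases hhit : ∃ i ∈ X, A j i = true
      · rw [gain, if_pos hhit]
        linarith
      · cases hy : y j
        · rw [hy] at hnn'
          have : gain X S (α * C₁) (A j) ≤ rowSum S (A j) := by
            rw [gain, if_neg hhit]
            exact min_le_left _ _
          simpa [rowSum, bit] using this
        · have hout : outcome A x j = false := by
            simp only [outcome, decide_eq_false_iff_not]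
            rintro ⟨i, hi, hxi⟩
            exact hhit ⟨i, hxX (by simp [hxi]), hi⟩
          have := gain_le X S hτ (A j)
          simpa [hout] using this
    have hsum := Finset.sum_le_sum fun j (_ : j ∈ Finset.univ) => hpt j
    rw [Finset.sum_add_distrib, Finset.sum_comm, ← Finset.mul_sum, Finset.sum_boole] at hsum
    have hmiss : ∀ i ∈ S, ∑ j, (if A j i = true ∧ y j = false then (1 : ℝ) else 0) ≤
        (a / b : ℝ) * M / D := by
      intro i hi
      have hz := (Finset.mem_filter.1 (hSZ hi)).2.2
      replace hz : missCount A y i * (b * D) ≤ a * M := of_decide_eq_true hz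
      rw [missCount] at hz
      rw [Finset.sum_boole, le_div_iff₀ hD₀, div_mul_eq_mul_div, le_div_iff₀ hb₀]
      have hz' : ((Finset.univ.filter fun j => A j i = true ∧ y j = false).card : ℝ) * (b * D) ≤
          a * M := by exact_mod_cast hz
      linarith
    have hS' := Finset.sum_le_card_nsmul _ _ _ hmiss
    rw [nsmul_eq_mul, hS] at hS'
    have h2 : ((C₁ * D : ℕ) : ℝ) * ((a / b : ℝ) * M / D) = (a / b : ℝ) * C₁ * M := by
      push_cast
      field_simp
    have h0' := mul_le_mul_of_nonneg_left ((Nat.cast_le (α := ℝ).2 h0).trans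
      (Nat.floor_le (by positivity : 0 ≤ p * M))) hτ
    linarith
  · rw [Nat.le_zero, Finset.card_eq_zero, Finset.filter_eq_empty_iff]
    rintro i - ⟨hxi, hzi⟩
    simp only [thresholdDecode, decide_eq_false_iff_not] at hzi
    apply hzi
    have hle : missCount A y i ≤ ⌊ν / D * M⌋₊ := by
      refine le_trans (Finset.card_le_card fun j hj => ?_) h1
      simp only [Finset.mem_filter, Finset.mem_univ, true_and] at hj ⊢
      exact ⟨by simpa [outcome] using ⟨i, hj.1, hxi⟩, hj.2⟩
    have hle' : (missCount A y i : ℝ) ≤ (a / b : ℝ) / D * M :=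
      ((Nat.cast_le (α := ℝ).2 hle).trans (Nat.floor_le (by positivity))).trans (by gcongr)
    rw [div_div, div_mul_eq_mul_div, le_div_iff₀ (by positivity)] at hle'
    exact_mod_cast hle'

end GroupTesting

/-! ### Executing the decoder on the word RAM. -/

namespace WordRAM

theorem run_add (P : Program) (w s t : ℕ) (σ : State) :
    run P w (s + t) σ = run P w t (run P w s σ) := by
  rw [run, run, run, Nat.add_comm, Function.iterate_add_apply]

theorem run_zero (P : Program) (w : ℕ) (σ : State) : run P w 0 σ = σ := rfl

theorem run_succ (P : Program) (w t : ℕ) (σ : State) :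
    run P w (t + 1) σ = run P w t (step P w σ) := rfl

theorem run_of_halted {P : Program} {σ : State} (h : Halted P σ) (w t : ℕ) :
    run P w t σ = σ := by
  refine Function.iterate_fixed ?_ t
  rw [step, List.getElem?_eq_none h]

end WordRAM

namespace GroupTesting

open WordRAM

/-- Threshold decoding as a program. Registers `5` and `6` hold the current item and test,
register `7` the number of negative tests of the item seen so far, register `8` the address of the
current matrix entry, register `14` the address of the current output bit, and registers `3`, `4`,
`12`, `13` the numbers `M * N`, `a * M`, `1`, `b * D`. -/
def thresholdProgram (a b : ℕ) : Program :=
  [.const 12 1, .mul 3 0 1, .const 4 a, .mul 4 4 0, .const 13 b, .mul 13 13 2, .add 14 3 0,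
    .jumpLe 1 5 27, .const 7 0, .const 6 0, .add 8 5 15,
    .jumpLe 0 6 20, .load 10 8, .add 9 3 6, .load 11 9, .sub 10 10 11, .add 7 7 10, .add 6 6 12,
    .add 8 8 1, .jump 11,
    .mul 10 7 13, .jumpLe 10 4 23, .jump 24, .store 14 12,
    .add 14 14 12, .add 5 5 12, .jump 7]

/-- The contents of the registers that stay fixed while the item `i` is examined. -/
structure ItemRegs (M N D a b i : ℕ) (reg : ℕ → ℕ) : Prop where
  r0 : reg 0 = M
  r1 : reg 1 = N
  r3 : reg 3 = M * N
  r4 : reg 4 = a * M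
  r5 : reg 5 = i
  r12 : reg 12 = 1
  r13 : reg 13 = b * D
  r14 : reg 14 = M * N + M + i
  r15 : reg 15 = 0

/-- The number of negative tests among the first `j` that contain the item `i`, computed from the
memory. -/
def memCount (M N i : ℕ) (m : ℕ → ℕ) (j : ℕ) : ℕ :=
  ∑ k ∈ Finset.range j, (m (k * N + i) - m (M * N + k))

theorem memCount_le {M N i : ℕ} {m : ℕ → ℕ} (hm : ∀ x, m x ≤ 1) (j : ℕ) :
    memCount M N i m j ≤ j := by
  have := Finset.sum_le_card_nsmul (Finset.range j)
    (fun k => m (k * N + i) - m (M * N + k)) 1 fun k _ => (Nat.sub_le _ _).trans (hm _)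
  simpa [memCount] using this

theorem run_thresholdProgram_test {M N D a b w i j : ℕ} {reg m : ℕ → ℕ}
    (hw : M * N + M + N < 2 ^ w) (hm : ∀ x, m x ≤ 1) (hj : j < M) (hi : i < N)
    (hreg : ItemRegs M N D a b i reg) (h6 : reg 6 = j) (h7 : reg 7 = memCount M N i m j)
    (h8 : reg 8 = j * N + i) :
    ∃ reg' : ℕ → ℕ, run (thresholdProgram a b) w 9 ⟨11, reg, m⟩ = ⟨11, reg', m⟩ ∧
      ItemRegs M N D a b i reg' ∧ reg' 6 = j + 1 ∧ reg' 7 = memCount M N i m (j + 1) ∧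
      reg' 8 = (j + 1) * N + i := by
  obtain ⟨r0, r1, r3, r4, r5, r12, r13, r14, r15⟩ := hreg
  have hcnt := memCount_le (M := M) (N := N) (i := i) hm j
  have hcnt' := memCount_le (M := M) (N := N) (i := i) hm (j + 1)
  have hsucc : memCount M N i m j + (m (j * N + i) - m (M * N + j)) = memCount M N i m (j + 1) := by
    rw [memCount, memCount, Finset.sum_range_succ]
  have hA := hm (j * N + i)
  have hy := hm (M * N + j)
  have hjN : j * N + N ≤ M * N := by
    rw [← Nat.succ_mul]; exact Nat.mul_le_mul_right N hj
  have e1 : m (j * N + i) % 2 ^ w = m (j * N + i) := Nat.mod_eq_of_lt (by omega)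
  have e2 : (M * N + j) % 2 ^ w = M * N + j := Nat.mod_eq_of_lt (by omega)
  have e3 : m (M * N + j) % 2 ^ w = m (M * N + j) := Nat.mod_eq_of_lt (by omega)
  have e4 : (m (j * N + i) - m (M * N + j)) % 2 ^ w = m (j * N + i) - m (M * N + j) :=
    Nat.mod_eq_of_lt (by omega)
  have e5 : memCount M N i m (j + 1) % 2 ^ w = memCount M N i m (j + 1) :=
    Nat.mod_eq_of_lt (by omega)
  have e6 : (j + 1) % 2 ^ w = j + 1 := Nat.mod_eq_of_lt (by omega)
  have e7 : (j * N + i + N) % 2 ^ w = j * N + i + N := Nat.mod_eq_of_lt (by omega)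
  -- The final registers stay a metavariable until symbolic execution by `simp` and then `rfl`
  -- determine them.
  refine ⟨?_, ?_, ?_, ?_, ?_, ?_⟩
  rotate_left
  · simp [run_succ, run_zero, step, thresholdProgram, exec, State.setReg, h6, h7, h8, r0, r1, r3,
      r12, hj.not_ge, e1, e2, e3, e4, e5, e6, e7, hsucc]
    rfl
  · constructor <;> simp [*]
  · simp
  · simp
  · simp; ring

theorem run_thresholdProgram_tests {M N D a b w i : ℕ} {m : ℕ → ℕ}
    (hw : M * N + M + N < 2 ^ w) (hm : ∀ x, m x ≤ 1) (hi : i < N) (j : ℕ) (hj : j ≤ M)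
    {reg : ℕ → ℕ} (hreg : ItemRegs M N D a b i reg) (h6 : reg 6 = 0) (h7 : reg 7 = 0)
    (h8 : reg 8 = i) :
    ∃ reg' : ℕ → ℕ, run (thresholdProgram a b) w (9 * j) ⟨11, reg, m⟩ = ⟨11, reg', m⟩ ∧
      ItemRegs M N D a b i reg' ∧ reg' 6 = j ∧ reg' 7 = memCount M N i m j ∧
      reg' 8 = j * N + i := by
  induction j with
  | zero => exact ⟨reg, rfl, hreg, h6, by simp [h7, memCount], by simp [h8]⟩
  | succ j ih =>
    obtain ⟨reg₁, hrun, hreg₁, h6₁, h7₁, h8₁⟩ := ih (by omega)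
    rw [Nat.mul_succ, run_add, hrun]
    exact run_thresholdProgram_test hw hm hj hi hreg₁ h6₁ h7₁ h8₁

/-- Four steps set up the item, each test costs nine, and seven leave the loop, compare and advance.
Keeping and rejecting take equally many steps, so the running time is exact. -/
theorem run_thresholdProgram_item {M N D a b w i : ℕ} {reg m : ℕ → ℕ}
    (hw : M * N + M + N < 2 ^ w) (hwb : M * (b * D) < 2 ^ w) (hm : ∀ x, m x ≤ 1) (hi : i < N)
    (hreg : ItemRegs M N D a b i reg) :
    ∃ reg' : ℕ → ℕ, run (thresholdProgram a b) w (9 * M + 11) ⟨7, reg, m⟩ =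
        ⟨7, reg', if memCount M N i m M * (b * D) ≤ a * M then
          Function.update m (M * N + M + i) 1 else m⟩ ∧
      ItemRegs M N D a b (i + 1) reg' := by
  have e0 : i % 2 ^ w = i := Nat.mod_eq_of_lt (by omega)
  have hstart : ∃ reg₁ : ℕ → ℕ, run (thresholdProgram a b) w 4 ⟨7, reg, m⟩ = ⟨11, reg₁, m⟩ ∧
      ItemRegs M N D a b i reg₁ ∧ reg₁ 6 = 0 ∧ reg₁ 7 = 0 ∧ reg₁ 8 = i := by
    obtain ⟨r0, r1, r3, r4, r5, r12, r13, r14, r15⟩ := hreg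
    refine ⟨?_, ?_, ?_, ?_, ?_, ?_⟩
    rotate_left
    · simp [run_succ, run_zero, step, thresholdProgram, exec, State.setReg, r1, r5, r15, e0,
        hi.not_ge]
      rfl
    · constructor <;> simp [*]
    · simp
    · simp
    · simp
  obtain ⟨reg₁, hrun₁, hreg₁, h6₁, h7₁, h8₁⟩ := hstart
  obtain ⟨reg₂, hrun₂, ⟨r0, r1, r3, r4, r5, r12, r13, r14, r15⟩, h6₂, h7₂, -⟩ :=
    run_thresholdProgram_tests hw hm hi M le_rfl hreg₁ h6₁ h7₁ h8₁
  rw [show 9 * M + 11 = 4 + (9 * M + 7) by ring, run_add, hrun₁, run_add, hrun₂]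
  have e1 : memCount M N i m M * (b * D) % 2 ^ w = memCount M N i m M * (b * D) :=
    Nat.mod_eq_of_lt (lt_of_le_of_lt (Nat.mul_le_mul_right _ (memCount_le hm M)) hwb)
  have e2 : (M * N + M + i + 1) % 2 ^ w = M * N + M + i + 1 := Nat.mod_eq_of_lt (by omega)
  have e3 : (i + 1) % 2 ^ w = i + 1 := Nat.mod_eq_of_lt (by omega)
  by_cases hacc : memCount M N i m M * (b * D) ≤ a * M
  · refine ⟨?_, ?_, ?_⟩
    rotate_left
    · simp [run_succ, run_zero, step, thresholdProgram, exec, State.setReg, r0, r4, r5, r12, r13,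
        r14, h6₂, h7₂, e1, e2, e3, hacc]
      rfl
    · constructor <;> simp [*, add_assoc]
  · refine ⟨?_, ?_, ?_⟩
    rotate_left
    · simp [run_succ, run_zero, step, thresholdProgram, exec, State.setReg, r0, r4, r5, r12, r13,
        r14, h6₂, h7₂, e1, e2, e3, hacc]
      rfl
    · constructor <;> simp [*, add_assoc]

/-! ### Memory layout: input, partial output, and the loop over items. -/

open Classical in
/-- The memory `m` after the first `k` bits of the output `z` have been written. -/
noncomputable def outMem {N : ℕ} (M : ℕ) (m : ℕ → ℕ) (z : Fin N → Bool) (k : ℕ) : ℕ → ℕ :=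
  fun x => if ∃ i : Fin N, i < k ∧ x = M * N + M + i ∧ z i = true then 1 else m x

theorem outMem_le {M N : ℕ} {m : ℕ → ℕ} (hm : ∀ x, m x ≤ 1) (z : Fin N → Bool) (k x : ℕ) :
    outMem M m z k x ≤ 1 := by
  unfold outMem
  split_ifs
  · exact le_rfl
  · exact hm x

theorem outMem_of_lt {M N : ℕ} (m : ℕ → ℕ) (z : Fin N → Bool) (k : ℕ) {x : ℕ}
    (hx : x < M * N + M) : outMem M m z k x = m x := by
  unfold outMem
  rw [if_neg]
  rintro ⟨i, -, h, -⟩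
  omega

theorem outMem_zero {M N : ℕ} (m : ℕ → ℕ) (z : Fin N → Bool) : outMem M m z 0 = m := by
  funext x
  simp [outMem]

theorem outMem_succ {M N : ℕ} (m : ℕ → ℕ) (z : Fin N → Bool) (i : Fin N) :
    outMem M m z (i + 1) = if z i = true then
      Function.update (outMem M m z i) (M * N + M + i) 1 else outMem M m z i := by
  funext x
  have hiff : (∃ k : Fin N, (k : ℕ) < i + 1 ∧ x = M * N + M + k ∧ z k = true) ↔
      (∃ k : Fin N, (k : ℕ) < i ∧ x = M * N + M + k ∧ z k = true) ∨
        (x = M * N + M + i ∧ z i = true) := by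
    constructor
    · rintro ⟨k, hk, hx, hz⟩
      rcases Nat.lt_succ_iff_lt_or_eq.1 hk with h | h
      · exact Or.inl ⟨k, h, hx, hz⟩
      · obtain rfl := Fin.ext h
        exact Or.inr ⟨hx, hz⟩
    · rintro (⟨k, hk, hx, hz⟩ | ⟨hx, hz⟩)
      · exact ⟨k, by omega, hx, hz⟩
      · exact ⟨i, by omega, hx, hz⟩
  by_cases hz : z i = true
  · rw [if_pos hz, Function.update_apply]
    by_cases hx : x = M * N + M + i
    · rw [if_pos hx, outMem, if_pos (hiff.2 (Or.inr ⟨hx, hz⟩))]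
    · rw [if_neg hx]
      unfold outMem
      simp only [hiff, hx, false_and, or_false]
  · rw [if_neg hz]
    unfold outMem
    simp only [hiff, hz, and_false, or_false, Bool.false_eq_true]

section Input

variable {M N : ℕ} (A : Matrix (Fin M) (Fin N) Bool) (D : ℕ) (y : Fin M → Bool)

theorem decoderInput_mem_le (x : ℕ) : (decoderInput A D y).mem x ≤ 1 := by
  simp only [decoderInput]
  split_ifs <;> norm_num

theorem decoderInput_mem_matrix (j : Fin M) (i : Fin N) :
    (decoderInput A D y).mem (j * N + i) = if A j i = true then 1 else 0 := by
  have hN : 0 < N := i.pos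
  have h1 : (∃ q : Fin M × Fin N, (j * N + i : ℕ) = q.1 * N + q.2 ∧ A q.1 q.2 = true) ↔
      A j i = true := by
    constructor
    · rintro ⟨⟨k, l⟩, h, hA⟩
      simp only at h hA
      have hk : (j : ℕ) = k := by
        have := congrArg (· / N) h
        simpa [Nat.mul_comm _ N, Nat.mul_add_div hN, Nat.div_eq_of_lt] using this
      have hl : (i : ℕ) = l := by rw [hk] at h; omega
      rwa [Fin.ext hk, Fin.ext hl]
    · exact fun h => ⟨(j, i), rfl, h⟩
  have h2 : ¬ ∃ k : Fin M, (j * N + i : ℕ) = M * N + k ∧ y k = true := by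
    rintro ⟨k, h, -⟩
    have : (j + 1) * N ≤ M * N := Nat.mul_le_mul_right N j.isLt
    rw [add_mul] at this
    omega
  simp only [decoderInput, h1, h2, if_false]

theorem not_exists_matrix_address {x : ℕ} (hx : M * N ≤ x) :
    ¬ ∃ q : Fin M × Fin N, x = q.1 * N + q.2 ∧ A q.1 q.2 = true := by
  rintro ⟨⟨k, l⟩, h, -⟩
  have : (k + 1) * N ≤ M * N := Nat.mul_le_mul_right N k.isLt
  rw [add_mul] at this
  simp only at h
  omega

theorem decoderInput_mem_outcome (j : Fin M) :
    (decoderInput A D y).mem (M * N + j) = if y j = true then 1 else 0 := by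
  have h2 : (∃ k : Fin M, (M * N + j : ℕ) = M * N + k ∧ y k = true) ↔ y j = true := by
    constructor
    · rintro ⟨k, h, hy⟩
      have hk : (j : ℕ) = k := by omega
      rwa [Fin.ext hk]
    · exact fun h => ⟨j, rfl, h⟩
  simp only [decoderInput, not_exists_matrix_address A (Nat.le_add_right _ _), h2, if_false]

theorem decoderInput_mem_output (i : ℕ) : (decoderInput A D y).mem (M * N + M + i) = 0 := by
  have h2 : ¬ ∃ k : Fin M, (M * N + M + i : ℕ) = M * N + k ∧ y k = true := by
    rintro ⟨k, h, -⟩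
    omega
  simp only [decoderInput, not_exists_matrix_address A (show M * N ≤ M * N + M + i by omega), h2,
    if_false]

/-- Output bits lie beyond `A` and `y`, so writing them does not disturb later counts. The truncated
difference of two bits is 1 exactly for a one of `A` in a negative test. -/
theorem memCount_outMem (z : Fin N → Bool) (k : ℕ) (i : Fin N) :
    memCount M N i (outMem M (decoderInput A D y).mem z k) M = missCount A y i := by
  rw [memCount, missCount, Finset.card_filter, ← Fin.sum_univ_eq_sum_range
    (fun k' => outMem M (decoderInput A D y).mem z k (k' * N + i) -
      outMem M (decoderInput A D y).mem z k (M * N + k'))]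
  refine Finset.sum_congr rfl fun j _ => ?_
  have h1 : (j * N + i : ℕ) < M * N + M := by
    have : (j + 1) * N ≤ M * N := Nat.mul_le_mul_right N j.isLt
    rw [add_mul] at this
    omega
  rw [outMem_of_lt _ _ _ h1, outMem_of_lt _ _ _ (by omega), decoderInput_mem_matrix,
    decoderInput_mem_outcome]
  cases A j i <;> cases y j <;> simp

theorem hasOutput_outMem (z : Fin N → Bool) (pc : ℕ) (reg : ℕ → ℕ) :
    HasOutput M ⟨pc, reg, outMem M (decoderInput A D y).mem z N⟩ z := by
  intro i
  have h : (∃ k : Fin N, (k : ℕ) < N ∧ (M * N + M + i : ℕ) = M * N + M + k ∧ z k = true) ↔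
      z i = true := by
    constructor
    · rintro ⟨k, -, h, hz⟩
      have hk : (i : ℕ) = k := by omega
      rwa [Fin.ext hk]
    · exact fun h => ⟨i, i.isLt, rfl, h⟩
  simp only [outMem, h, decoderInput_mem_output]

theorem run_thresholdProgram_items {a b w : ℕ} (hw : M * N + M + N < 2 ^ w)
    (hwb : M * (b * D) < 2 ^ w) {reg : ℕ → ℕ} (hreg : ItemRegs M N D a b 0 reg) (i : ℕ)
    (hi : i ≤ N) :
    ∃ reg' : ℕ → ℕ, run (thresholdProgram a b) w ((9 * M + 11) * i)
        ⟨7, reg, (decoderInput A D y).mem⟩ =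
        ⟨7, reg', outMem M (decoderInput A D y).mem (thresholdDecode A D a b y) i⟩ ∧
      ItemRegs M N D a b i reg' := by
  induction i with
  | zero => exact ⟨reg, by rw [outMem_zero]; rfl, hreg⟩
  | succ i ih =>
    obtain ⟨reg₁, hrun, hreg₁⟩ := ih (by omega)
    obtain ⟨reg₂, hrun₂, hreg₂⟩ := run_thresholdProgram_item hw hwb
      (outMem_le (decoderInput_mem_le A D y) (thresholdDecode A D a b y) i) hi hreg₁
    refine ⟨reg₂, ?_, hreg₂⟩
    rw [Nat.mul_succ, run_add, hrun, hrun₂,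
      memCount_outMem A D y (thresholdDecode A D a b y) i ⟨i, hi⟩,
      outMem_succ _ _ (⟨i, hi⟩ : Fin N)]
    simp [thresholdDecode]

theorem run_thresholdProgram {a b w : ℕ} (hw : M * N + M + N < 2 ^ w)
    (hwa : a < 2 ^ w) (hwb : b < 2 ^ w) (hwaM : a * M < 2 ^ w) (hwbD : b * D < 2 ^ w)
    (hwMbD : M * (b * D) < 2 ^ w) (hN : 0 < N) :
    ∃ reg : ℕ → ℕ, run (thresholdProgram a b) w (7 + (9 * M + 11) * N + 1) (decoderInput A D y) =
      ⟨27, reg, outMem M (decoderInput A D y).mem (thresholdDecode A D a b y) N⟩ := by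
  have e1 : 1 % 2 ^ w = 1 := Nat.mod_eq_of_lt (by omega)
  have e2 : M * N % 2 ^ w = M * N := Nat.mod_eq_of_lt (by omega)
  have e3 : (M * N + M) % 2 ^ w = M * N + M := Nat.mod_eq_of_lt (by omega)
  have e4 := Nat.mod_eq_of_lt hwa
  have e5 := Nat.mod_eq_of_lt hwb
  have e6 := Nat.mod_eq_of_lt hwaM
  have e7 := Nat.mod_eq_of_lt hwbD
  have hstart : ∃ reg : ℕ → ℕ, run (thresholdProgram a b) w 7 (decoderInput A D y) =
      ⟨7, reg, (decoderInput A D y).mem⟩ ∧ ItemRegs M N D a b 0 reg := by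
    generalize hm : (decoderInput A D y).mem = m
    rw [show decoderInput A D y = ⟨0, fun r => if r = 0 then M else if r = 1 then N else
      if r = 2 then D else 0, m⟩ by rw [← hm]; rfl]
    refine ⟨?_, ?_, ?_⟩
    rotate_left
    · simp [run_succ, run_zero, step, thresholdProgram, exec, State.setReg]
      rfl
    · constructor <;> simp [*]
  obtain ⟨reg, hrun, hreg⟩ := hstart
  obtain ⟨reg₁, hrun₁, hreg₁⟩ := run_thresholdProgram_items A D y hw hwMbD hreg N le_rfl
  refine ⟨reg₁, ?_⟩
  rw [run_add, run_add, hrun, hrun₁]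
  simp [run_succ, run_zero, step, thresholdProgram, exec, hreg₁.r1, hreg₁.r5]

end Input

theorem reconstructs_thresholdProgram {M N D a b C e₀ e₁ e₀' e₁' : ℕ} (hM : 1 ≤ M) (hD : 1 ≤ D)
    (hDN : D ≤ N) (hC : a + b + 28 ≤ C) (A : Matrix (Fin M) (Fin N) Bool)
    (hA : ∀ y, IsValidDecoding A D e₀ e₁ e₀' e₁' y (thresholdDecode A D a b y)) :
    Reconstructs (thresholdProgram a b) (C * (M * N)) (C * (M * N)) A D e₀ e₁ e₀' e₁' := by
  intro y w hw
  have hN : 1 ≤ N := hD.trans hDN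
  have hMMN : M ≤ M * N := Nat.le_mul_of_pos_right M hN
  have hNMN : N ≤ M * N := Nat.le_mul_of_pos_left N hM
  have hCMN : a * (M * N) + b * (M * N) + 28 * (M * N) ≤ C * (M * N) := by
    rw [← add_mul, ← add_mul]
    exact Nat.mul_le_mul_right _ hC
  have haM : a * M ≤ a * (M * N) := Nat.mul_le_mul_left a hMMN
  have ha : a ≤ a * M := Nat.le_mul_of_pos_right a hM
  have hbM : M * (b * D) ≤ b * (M * N) := by
    calc M * (b * D) = b * (M * D) := by ring
      _ ≤ b * (M * N) := Nat.mul_le_mul_left b (Nat.mul_le_mul_left M hDN)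
  have hbD : b * D ≤ M * (b * D) := Nat.le_mul_of_pos_left _ hM
  have hb : b ≤ b * D := Nat.le_mul_of_pos_right b hD
  obtain ⟨reg, hrun⟩ := run_thresholdProgram A D y (a := a) (b := b) (w := w) (by omega)
    (by omega) (by omega) (by omega) (by omega) (by omega) hN
  -- The constant 28 is `9 + 11 + 8`, using `N ≤ M * N` and `1 ≤ M * N`.
  have hsteps : 7 + (9 * M + 11) * N + 1 ≤ C * (M * N) := by
    have : (9 * M + 11) * N = 9 * (M * N) + 11 * N := by ring
    omega
  have hhalt : Halted (thresholdProgram a b)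
      ⟨27, reg, outMem M (decoderInput A D y).mem (thresholdDecode A D a b y) N⟩ := le_rfl
  obtain ⟨s, hs⟩ := Nat.exists_eq_add_of_le hsteps
  rw [hs, run_add, hrun, run_of_halted hhalt]
  exact ⟨hhalt, _, hasOutput_outMem A D y _ _ _, hA y⟩

end GroupTesting

/-! ### Choice of constants. -/

theorem corollary1 (p ν : ℝ) (hp₀ : 0 ≤ p) (hp₁ : p < 1) (hν₀ : 0 ≤ ν)
    (hν₁ : ν < (Real.sqrt (5 - 4 * p) - 1) ^ 3 / 8) :
    ∃ (C : ℕ) (P : WordRAM.Program), ∀ D N : ℕ, 1 ≤ D → D ≤ N → 2 ≤ N →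
      ∃ (M : ℕ) (A : Matrix (Fin M) (Fin N) Bool),
        (M : ℝ) ≤ C * (D * Real.logb 2 N) ∧
        GroupTesting.IsCorrecting A D ⌊p * M⌋₊ ⌊ν / D * M⌋₊ (C * D) 0 ∧
        GroupTesting.Reconstructs P (C * (M * N)) (C * (M * N)) A
          D ⌊p * M⌋₊ ⌊ν / D * M⌋₊ (C * D) 0 := by
  -- The positive root of `α ^ 2 + α = 1 - p`, so that `α * (1 - α - p) = α ^ 3 = ν₀`.
  set α : ℝ := (Real.sqrt (5 - 4 * p) - 1) / 2 with hα
  have hsq : Real.sqrt (5 - 4 * p) ^ 2 = 5 - 4 * p := Real.sq_sqrt (by linarith)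
  have hsqrt : 1 < Real.sqrt (5 - 4 * p) := Real.lt_sqrt_of_sq_lt (by linarith)
  have hα₀ : 0 < α := by rw [hα]; linarith
  have hquad : 1 - α - p = α ^ 2 := by rw [hα]; nlinarith
  have hα₁ : α ≤ 1 := by nlinarith
  -- A rational threshold lets the program compare integers only, with `a` and `b` as literals.
  obtain ⟨β, hνβ, hβ⟩ := exists_rat_btwn hν₁
  have hβ₀ : 0 < β := by exact_mod_cast lt_of_le_of_lt hν₀ hνβ
  have hβcast : (β : ℝ) = (β.num.toNat : ℝ) / β.den := by
    have h := Int.toNat_of_nonneg (Rat.num_pos.2 hβ₀).le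
    have h' : ((β.num.toNat : ℤ) : ℝ) = (β.num : ℝ) := by rw [h]
    rw [Int.cast_natCast] at h'
    rw [h', Rat.cast_def]
  set a := β.num.toNat
  set b := β.den
  rw [hβcast] at hνβ hβ
  obtain ⟨C₁, C₂, hC₂, hmat⟩ := GroupTesting.exists_matrix_lt_sum_gain (β := (a : ℝ) / b) hα₀ hα₁
    (p := p) (by rw [hquad]; refine hβ.trans_eq ?_; rw [hα]; ring)
  -- The summands serve running time and word size, the number of false positives, and the number of
  -- tests; the factor 2 absorbs rounding `M` up.
  refine ⟨a + b + 28 + (C₁ + 1) + 2 * C₂, GroupTesting.thresholdProgram a b,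
    fun D N hD hDN hN => ?_⟩
  set C := a + b + 28 + (C₁ + 1) + 2 * C₂
  have hlog : 1 ≤ Real.logb 2 N := by
    rw [Real.le_logb_iff_rpow_le one_lt_two (by exact_mod_cast (by omega : 0 < N)), Real.rpow_one]
    exact_mod_cast hN
  have hD' : (1 : ℝ) ≤ D := by exact_mod_cast hD
  have hC₂' : (1 : ℝ) ≤ C₂ := by exact_mod_cast hC₂
  have hDlog : 1 ≤ D * Real.logb 2 N := one_le_mul_of_one_le_of_one_le hD' hlog
  have hC₂D : 1 ≤ C₂ * (D * Real.logb 2 N) := one_le_mul_of_one_le_of_one_le hC₂' hDlog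
  set M := ⌈C₂ * (D * Real.logb 2 N)⌉₊
  have hM₁ : 1 ≤ M := Nat.one_le_ceil_iff.2 (by linarith)
  obtain ⟨A, hA⟩ := hmat D N M hD hN (Nat.le_ceil _)
  have hvalid := GroupTesting.isValidDecoding_thresholdDecode (C := C) hα₀.le hp₀ hν₀ hD β.den_pos
    hνβ.le (by omega) hA
  refine ⟨M, A, ?_, fun y => ⟨_, hvalid y⟩,
    GroupTesting.reconstructs_thresholdProgram hM₁ hD hDN (by omega) A hvalid⟩
  have h2 : (2 * C₂ : ℝ) ≤ C := by
    have : 2 * C₂ ≤ C := by omega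
    exact_mod_cast this
  calc (M : ℝ) ≤ C₂ * (D * Real.logb 2 N) + 1 := (Nat.ceil_lt_add_one (by linarith)).le
    _ ≤ 2 * C₂ * (D * Real.logb 2 N) := by linarith
    _ ≤ C * (D * Real.logb 2 N) := mul_le_mul_of_nonneg_right h2 (by linarith)
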